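/- Let $A$ be a $C^*$-algebra (not necessarily unital), let $G$ be a discrete group, and let $\sigma\colon G\to \mathrm{Aut}(A)$ be an action of $G$ on $A$ by $*$-automorphisms. Write $A_+$ for the set of positive elements of $A$. The action $\sigma$ is called \emph{$G$-separating} if for all $a,b\in A_+$, $c\in A$ and $\varepsilon>0$ there are $s,t\in A$ and $g,h\in G$ such that $$\|s^*as-\sigma_g(a)\|<\varepsilon,\qquad \|t^*bt-\sigma_h(b)\|<\varepsilon,\qquad \|s^*ct\|<\varepsilon .$$ Let $A\rtimes_{\sigma,\lambda}G$ be the reduced crossed product: for a faithful $*$-representation $\pi$ of $A$ on a Hilbert space $H$, it is the $C^*$-algebra of operators on $\ell^2(G,H)$ generated by the operators $\tilde\pi(a)U(g)$ ($a\in A$, $g\in G$), where $(\tilde\pi(a)\xi)(h)=\pi(\sigma_{h^{-1}}(a))\xi(h)$ and $(U(g)\xi)(h)=\xi(g^{-1}h)$; up to canonical isomorphism it does not depend on $\pi$. The algebra $A$ is regarded as a $C^*$-subalgebra of $A\rtimes_{\sigma,\lambda}G$ through $\tilde\pi$. \textbf{Proposition.} For every such realisation of $A\rtimes_{\sigma,\lambda}G$,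 the following properties are equivalent: (i) The action $\sigma$ of $G$ on $A$ is $G$-separating. (ii) For all $a_1,a_2\in A_+$, every $c\in A\rtimes_{\sigma,\lambda}G$ and every $\varepsilon>0$ there are $d_1,d_2\in A$ and $g_1,g_2\in G$ such that the elements $s_j=d_jU(g_j)$ of $A\rtimes_{\sigma,\lambda}G$ satisfy $$\|s_j^*a_js_j-a_j\|<\varepsilon\quad (j=1,2)\qquad\text{and}\qquad \|s_1^*cs_2\|<\varepsilon .$$ -/

import Mathlib

open scoped ENNReal

noncomputable section

namespace CStarDynamics

universe u v w

set_option linter.unusedSectionVars false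

variable {G : Type u} [Group G] {A : Type v} [NonUnitalCStarAlgebra A]
  {H : Type w} [NormedAddCommGroup H] [InnerProductSpace ℂ H] [CompleteSpace H]

/-- The action `σ` of the discrete group `G` by `*`-automorphisms of the C*-algebra `A` is
`G`-separating. -/
def IsGSeparating [PartialOrder A] (σ : G →* (A ≃⋆ₐ[ℂ] A)) : Prop :=
  ∀ a b : A, 0 ≤ a → 0 ≤ b → ∀ c : A, ∀ ε : ℝ, 0 < ε →
    ∃ s t : A, ∃ g h : G,
      ‖star s * a * s - σ g a‖ < ε ∧ ‖star t * b * t - σ h b‖ < ε ∧ ‖star s * c * t‖ < ε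

variable (G H) in
/-- The Hilbert space `ℓ²(G, H)`. -/
abbrev EllTwo : Type (max u w) := lp (fun _ : G => H) 2

/-- A uniformly bounded family of operators on `H` acts diagonally on `ℓ²(G, H)`. -/
theorem memℓp_diagonal {T : G → H →L[ℂ] H} {C : ℝ} (hT : ∀ h, ‖T h‖ ≤ C) (ξ : EllTwo G H) :
    Memℓp (fun h => T h (ξ h)) 2 := by
  have h2 : (0 : ℝ) < (2 : ℝ≥0∞).toReal := by norm_num
  refine memℓp_gen (Summable.of_nonneg_of_le (fun h => by positivity) (fun h => ?_)
    (((lp.memℓp ξ).summable h2).mul_left (C ^ (2 : ℝ≥0∞).toReal)))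
  rw [← Real.mul_rpow ((norm_nonneg _).trans (hT h)) (norm_nonneg _)]
  exact Real.rpow_le_rpow (norm_nonneg _) ((T h).le_of_opNorm_le (hT h) _) h2.le

/-- The diagonal operator `(Tξ)(h) = T_h ξ(h)` on `ℓ²(G, H)`. -/
def diagonal (T : G → H →L[ℂ] H) (C : ℝ) (hT : ∀ h, ‖T h‖ ≤ C) :
    EllTwo G H →L[ℂ] EllTwo G H :=
  LinearMap.mkContinuous
    { toFun := fun ξ => ⟨fun h => T h (ξ h), memℓp_diagonal hT ξ⟩
      map_add' := fun ξ η => by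
        ext h
        exact map_add (T h) (ξ h) (η h)
      map_smul' := fun z ξ => by
        ext h
        exact map_smul (T h) z (ξ h) }
    C (fun ξ => by
      have hC : 0 ≤ C := (norm_nonneg _).trans (hT 1)
      have h2 : (0 : ℝ) < (2 : ℝ≥0∞).toReal := by norm_num
      refine lp.norm_le_of_forall_sum_le h2 (by positivity) (fun s => ?_)
      rw [Real.mul_rpow hC (norm_nonneg _)]
      calc ∑ h ∈ s, ‖T h (ξ h)‖ ^ (2 : ℝ≥0∞).toReal
          ≤ ∑ h ∈ s, C ^ (2 : ℝ≥0∞).toReal * ‖ξ h‖ ^ (2 : ℝ≥0∞).toReal := by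
            refine Finset.sum_le_sum fun h _ => ?_
            rw [← Real.mul_rpow hC (norm_nonneg _)]
            exact Real.rpow_le_rpow (norm_nonneg _) ((T h).le_of_opNorm_le (hT h) _) h2.le
        _ ≤ _ := by
            rw [← Finset.mul_sum]
            exact mul_le_mul_of_nonneg_left (lp.sum_rpow_le_norm_rpow h2 ξ s) (by positivity))

@[simp]
theorem diagonal_apply (T : G → H →L[ℂ] H) (C : ℝ) (hT : ∀ h, ‖T h‖ ≤ C) (ξ : EllTwo G H)
    (h : G) : diagonal T C hT ξ h = T h (ξ h) := rfl

/-- Two operators on `ℓ²(G, H)` are equal if all their coordinates are. -/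
theorem ext_coord {S T : EllTwo G H →L[ℂ] EllTwo G H} (h : ∀ ξ k, S ξ k = T ξ k) : S = T :=
  ContinuousLinearMap.ext fun ξ => lp.ext (funext (h ξ))

theorem norm_rep_le (σ : G →* (A ≃⋆ₐ[ℂ] A)) (π : A →⋆ₙₐ[ℂ] (H →L[ℂ] H)) (a : A) (h : G) :
    ‖π (σ h⁻¹ a)‖ ≤ ‖a‖ :=
  (NonUnitalStarAlgHom.norm_apply_le π _).trans (NonUnitalStarAlgHom.norm_apply_le (σ h⁻¹) a)

/-- The representation `π̃` of `A` on `ℓ²(G, H)` induced by a representation `π` of `A` on `H`: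
`(π̃(a)ξ)(h) = π(σ_{h⁻¹}(a)) ξ(h)`. -/
def inducedRep (σ : G →* (A ≃⋆ₐ[ℂ] A)) (π : A →⋆ₙₐ[ℂ] (H →L[ℂ] H)) :
    A →⋆ₙₐ[ℂ] (EllTwo G H →L[ℂ] EllTwo G H) where
  toFun a := diagonal (fun h => π (σ h⁻¹ a)) ‖a‖ (norm_rep_le σ π a)
  map_smul' z a := ext_coord fun ξ k => by simp
  map_zero' := ext_coord fun ξ k => by simp
  map_add' a b := ext_coord fun ξ k => by simp
  map_mul' a b := ext_coord fun ξ k => by simp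
  map_star' a := by
    rw [ContinuousLinearMap.star_eq_adjoint, ContinuousLinearMap.eq_adjoint_iff]
    intro ξ η
    rw [lp.inner_eq_tsum, lp.inner_eq_tsum]
    refine tsum_congr fun h => ?_
    rw [diagonal_apply, diagonal_apply, map_star, map_star, ContinuousLinearMap.star_eq_adjoint,
      ContinuousLinearMap.adjoint_inner_left]

@[simp]
theorem inducedRep_apply (σ : G →* (A ≃⋆ₐ[ℂ] A)) (π : A →⋆ₙₐ[ℂ] (H →L[ℂ] H)) (a : A)
    (ξ : EllTwo G H) (h : G) : inducedRep σ π a ξ h = π (σ h⁻¹ a) (ξ h) := rfl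

theorem memℓp_translate (g : G) (ξ : EllTwo G H) : Memℓp (fun h => ξ (g⁻¹ * h)) 2 :=
  memℓp_gen ((Equiv.mulLeft g⁻¹).summable_iff.2 ((lp.memℓp ξ).summable (by norm_num)))

theorem norm_translate (g : G) (ξ : EllTwo G H) :
    ‖(⟨fun h => ξ (g⁻¹ * h), memℓp_translate g ξ⟩ : EllTwo G H)‖ = ‖ξ‖ := by
  have h2 : (0 : ℝ) < (2 : ℝ≥0∞).toReal := by norm_num
  rw [lp.norm_eq_tsum_rpow h2, lp.norm_eq_tsum_rpow h2]
  congr 1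
  exact (Equiv.mulLeft g⁻¹).tsum_eq (fun h => ‖ξ h‖ ^ (2 : ℝ≥0∞).toReal)

variable (H) in
/-- Left translation `(λ_g ξ)(h) = ξ(g⁻¹h)` on `ℓ²(G, H)`. -/
def translation (g : G) : EllTwo G H →L[ℂ] EllTwo G H :=
  LinearMap.mkContinuous
    { toFun := fun ξ => ⟨fun h => ξ (g⁻¹ * h), memℓp_translate g ξ⟩
      map_add' := fun _ _ => rfl
      map_smul' := fun _ _ => rfl }
    1 (fun ξ => by
      rw [one_mul]
      exact (norm_translate g ξ).le)

@[simp]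
theorem translation_apply (g : G) (ξ : EllTwo G H) (h : G) :
    translation H g ξ h = ξ (g⁻¹ * h) := rfl

theorem star_translation (g : G) : star (translation H g) = translation H g⁻¹ := by
  symm
  rw [ContinuousLinearMap.star_eq_adjoint, ContinuousLinearMap.eq_adjoint_iff]
  intro ξ η
  rw [lp.inner_eq_tsum, lp.inner_eq_tsum, ← (Equiv.mulLeft g⁻¹).tsum_eq]
  refine tsum_congr fun h => ?_
  simp

variable (G H) in
/-- The canonical unitary representation `U = λ` of `G` on `ℓ²(G, H)`. -/
def regularRep : G →* unitary (EllTwo G H →L[ℂ] EllTwo G H) where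
  toFun g := ⟨translation H g, by
    rw [Unitary.mem_iff, star_translation]
    exact ⟨ext_coord fun ξ k => by simp, ext_coord fun ξ k => by simp⟩⟩
  map_one' := Subtype.ext (ext_coord fun ξ k => by simp)
  map_mul' g h := Subtype.ext (ext_coord fun ξ k => by simp [mul_assoc])

@[simp]
theorem regularRep_apply (g : G) (ξ : EllTwo G H) (h : G) :
    (regularRep G H g : EllTwo G H →L[ℂ] EllTwo G H) ξ h = ξ (g⁻¹ * h) := rfl

/-- `U(g) π̃(a) U(g)* = π̃(σ_g(a))`. -/
theorem covariance (σ : G →* (A ≃⋆ₐ[ℂ] A)) (π : A →⋆ₙₐ[ℂ] (H →L[ℂ] H)) (a : A) (g : G) :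
    (regularRep G H g : EllTwo G H →L[ℂ] EllTwo G H) * inducedRep σ π a *
      star (regularRep G H g : EllTwo G H →L[ℂ] EllTwo G H) = inducedRep σ π (σ g a) := by
  rw [← Unitary.coe_star, Unitary.star_eq_inv, ← map_inv]
  refine ext_coord fun ξ k => ?_
  change π (σ (g⁻¹ * k)⁻¹ a) (ξ (g⁻¹⁻¹ * (g⁻¹ * k))) = π (σ k⁻¹ (σ g a)) (ξ k)
  simp only [inv_inv, mul_inv_cancel_left, mul_inv_rev, map_mul]
  rfl

/-- The reduced crossed product `A ⋊_{σ,λ} G`, realised on `ℓ²(G, H)` through a faithful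
representation `π` of `A` on `H`: the C*-algebra generated by the operators `π̃(a) U(g)`, for `a`
in `A` and `g` in `G`. Up to canonical isomorphism it does not depend on the faithful
representation `π`. -/
def reducedCrossedProduct (σ : G →* (A ≃⋆ₐ[ℂ] A)) (π : A →⋆ₙₐ[ℂ] (H →L[ℂ] H)) :
    NonUnitalStarSubalgebra ℂ (EllTwo G H →L[ℂ] EllTwo G H) :=
  (NonUnitalStarAlgebra.adjoin ℂ
    {T | ∃ (a : A) (g : G),
      T = inducedRep σ π a * (regularRep G H g : EllTwo G H →L[ℂ] EllTwo G H)}).topologicalClosure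

theorem monomial_mem (σ : G →* (A ≃⋆ₐ[ℂ] A)) (π : A →⋆ₙₐ[ℂ] (H →L[ℂ] H)) (d : A) (g : G) :
    inducedRep σ π d * (regularRep G H g : EllTwo G H →L[ℂ] EllTwo G H) ∈
      reducedCrossedProduct σ π :=
  NonUnitalStarSubalgebra.le_topologicalClosure _
    (NonUnitalStarAlgebra.subset_adjoin ℂ _ ⟨d, g, rfl⟩)

theorem inducedRep_mem (σ : G →* (A ≃⋆ₐ[ℂ] A)) (π : A →⋆ₙₐ[ℂ] (H →L[ℂ] H)) (a : A) :
    inducedRep σ π a ∈ reducedCrossedProduct σ π := by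
  simpa using monomial_mem σ π a 1

/-- The canonical inclusion of `A` in the reduced crossed product. -/
def incl (σ : G →* (A ≃⋆ₐ[ℂ] A)) (π : A →⋆ₙₐ[ℂ] (H →L[ℂ] H)) :
    A →⋆ₙₐ[ℂ] reducedCrossedProduct σ π :=
  NonUnitalStarAlgHom.codRestrict (inducedRep σ π) (reducedCrossedProduct σ π)
    (inducedRep_mem σ π)

/-- The element `d U(g)` of the reduced crossed product. -/
def monomial (σ : G →* (A ≃⋆ₐ[ℂ] A)) (π : A →⋆ₙₐ[ℂ] (H →L[ℂ] H)) (d : A) (g : G) :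
    reducedCrossedProduct σ π :=
  ⟨inducedRep σ π d * (regularRep G H g : EllTwo G H →L[ℂ] EllTwo G H), monomial_mem σ π d g⟩

end CStarDynamics

end

/-! Translations are unitary and `σ` is implemented by them, so for `s = d U(g)` the norm of `s* a s
- a` equals that of `d* a d - σ_g(a)`, and `s₁* c s₂` has the norm of `d₁* c d₂` when `c` is in `A`.
As `π̃` is isometric, (ii) restricted to `c` in `A` is exactly (i).

For the converse, a single monomial `c U(g)` is handled by applying (i) to `σ_g(b)`. For finitely
many, proceed by induction: if `s₁, s₂` work for `S`, then `s₁* c s₂` is again a monomial; choose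
`t₁, t₂` for it and take `s_j t_j`. The errors of `s_j` get multiplied by norms of `t_j`, which must
therefore be bounded before `s_j` is chosen. The cut-down gives this: with `k = (a - η)₊ = ψ* a ψ`,
any `s` with `s* k s` near `k` can be replaced by `ψ s`, which has controlled norm. The same bound
passes the result from the span of monomials to its closure. -/

namespace CStarDynamics

/-! ### Cut-downs of positive elements -/

section CutDown

variable {A : Type*} [NonUnitalCStarAlgebra A] [PartialOrder A] [StarOrderedRing A]

/-- The cut-down `k = (a - η)₊` of a positive element is `ψ* a ψ`, where `ψ = φ k^{1/2}`. -/
theorem exists_cutDown {a : A} (ha : 0 ≤ a) {η : ℝ} (hη : 0 < η) :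
    ∃ k y φ : A, 0 ≤ k ∧ ‖k - a‖ ≤ η ∧ star y * y = k ∧ star (φ * y) * a * (φ * y) = k := by
  have hsa : IsSelfAdjoint a := ha.isSelfAdjoint
  have hq : ∀ t ∈ quasispectrum ℝ a, 0 ≤ t := fun t ht => quasispectrum_nonneg_of_nonneg a ha t ht
  have hmax : ∀ t : ℝ, max t η ≠ 0 := fun t => (lt_max_of_lt_right hη).ne'
  have hf0 : max ((0 : ℝ) - η) 0 = 0 := max_eq_right (by linarith)
  have hf : Continuous fun t : ℝ => max (t - η) 0 := by fun_prop
  have hg : Continuous fun t : ℝ => √(max (t - η) 0) := by fun_prop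
  -- This is `t^{-1/2}` for `t ≥ η`. The `max` keeps it continuous and zero at `0`; its values below
  -- `η` are irrelevant, since `(t - η)₊` vanishes there.
  have hp : Continuous fun t : ℝ => √t / max t η :=
    Real.continuous_sqrt.div (by fun_prop) hmax
  have hg0 : √(max ((0 : ℝ) - η) 0) = 0 := by rw [hf0, Real.sqrt_zero]
  have hp0 : √(0 : ℝ) / max 0 η = 0 := by simp
  have hys : IsSelfAdjoint (cfcₙ (fun t : ℝ => √(max (t - η) 0)) a) := cfcₙ_predicate _ a
  have hps : IsSelfAdjoint (cfcₙ (fun t : ℝ => √t / max t η) a) := cfcₙ_predicate _ a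
  refine ⟨cfcₙ (fun t : ℝ => max (t - η) 0) a, cfcₙ (fun t : ℝ => √(max (t - η) 0)) a,
    cfcₙ (fun t : ℝ => √t / max t η) a, cfcₙ_nonneg fun t _ => le_max_right _ _, ?_, ?_, ?_⟩
  · nth_rewrite 2 [← cfcₙ_id' ℝ a]
    rw [← cfcₙ_sub _ _ a hf.continuousOn hf0 continuous_id'.continuousOn rfl]
    refine norm_cfcₙ_le fun t ht => ?_
    have := hq t ht
    rw [Real.norm_eq_abs, abs_le]
    rcases max_cases (t - η) 0 with h | h <;> constructor <;> linarith
  · rw [hys.star_eq, ← cfcₙ_mul _ _ a hg.continuousOn hg0 hg.continuousOn hg0]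
    exact cfcₙ_congr fun t _ => Real.mul_self_sqrt (le_max_right _ _)
  · rw [star_mul, hys.star_eq, hps.star_eq]
    nth_rewrite 3 [← cfcₙ_id' ℝ a]
    have hgp : Continuous fun t : ℝ => √(max (t - η) 0) * (√t / max t η) := hg.mul hp
    have hpg : Continuous fun t : ℝ => √t / max t η * √(max (t - η) 0) := hp.mul hg
    have hgpt : Continuous fun t : ℝ => √(max (t - η) 0) * (√t / max t η) * t :=
      hgp.mul continuous_id'
    rw [← cfcₙ_mul _ _ a hg.continuousOn hg0 hp.continuousOn hp0,
      ← cfcₙ_mul _ _ a hp.continuousOn hp0 hg.continuousOn hg0,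
      ← cfcₙ_mul _ _ a hgp.continuousOn (by simp) continuous_id'.continuousOn rfl,
      ← cfcₙ_mul _ _ a hgpt.continuousOn (by simp) hpg.continuousOn (by simp)]
    refine cfcₙ_congr fun t ht => ?_
    have h0 := hq t ht
    rcases le_total t η with h | h
    · simp [max_eq_right (sub_nonpos.2 h)]
    · have ht0 : t ≠ 0 := (hη.trans_le h).ne'
      have h1 := Real.mul_self_sqrt h0
      have h2 := Real.mul_self_sqrt (sub_nonneg.2 h)
      rw [max_eq_left (sub_nonneg.2 h), max_eq_left h]
      calc √(t - η) * (√t / t) * t * (√t / t * √(t - η))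
          = (√(t - η) * √(t - η)) * (√t * √t) / t := by field_simp
        _ = t - η := by rw [h1, h2]; field_simp

end CutDown

/-! ### Covariance and the calculus of monomials -/

variable {G : Type*} [Group G] {A : Type*} [NonUnitalCStarAlgebra A]
  {H : Type*} [NormedAddCommGroup H] [InnerProductSpace ℂ H] [CompleteSpace H]
  (σ : G →* (A ≃⋆ₐ[ℂ] A)) (π : A →⋆ₙₐ[ℂ] (H →L[ℂ] H))

/-- The set of operators `d U(g)` on `ℓ²(G, H)`. -/
def monomials : Set (EllTwo G H →L[ℂ] EllTwo G H) :=
  {T | ∃ (d : A) (g : G), T = inducedRep σ π d * (regularRep G H g : EllTwo G H →L[ℂ] EllTwo G H)}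

theorem inducedRep_injective (hπ : Function.Injective π) :
    Function.Injective (inducedRep σ π) := by
  classical
  refine (injective_iff_map_eq_zero _).2 fun a ha => (injective_iff_map_eq_zero π).1 hπ a ?_
  ext v
  -- At the coordinate `1` no automorphism intervenes, so `π̃(a)` acts there as `π(a)`.
  have h : inducedRep σ π a (lp.single 2 (1 : G) v) 1 = 0 := by rw [ha]; rfl
  simpa using h

theorem norm_inducedRep (hπ : Function.Injective π) (a : A) : ‖inducedRep σ π a‖ = ‖a‖ :=
  NonUnitalStarAlgHom.norm_map _ (inducedRep_injective σ π hπ) a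

theorem regularRep_mul_inducedRep (g : G) (a : A) :
    (regularRep G H g : EllTwo G H →L[ℂ] EllTwo G H) * inducedRep σ π a =
      inducedRep σ π (σ g a) * (regularRep G H g : EllTwo G H →L[ℂ] EllTwo G H) := by
  rw [← covariance, mul_assoc, Unitary.coe_star_mul_self, mul_one]

theorem star_regularRep (g : G) :
    star (regularRep G H g : EllTwo G H →L[ℂ] EllTwo G H) = regularRep G H g⁻¹ := by
  rw [← Unitary.coe_star, Unitary.star_eq_inv, ← map_inv]

/-- `U(g)* π̃(σ_g(a)) U(g) = π̃(a)`. -/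
theorem star_regularRep_conj (g : G) (a : A) :
    star (regularRep G H g : EllTwo G H →L[ℂ] EllTwo G H) * inducedRep σ π (σ g a) *
      (regularRep G H g : EllTwo G H →L[ℂ] EllTwo G H) = inducedRep σ π a := by
  rw [mul_assoc, ← regularRep_mul_inducedRep, ← mul_assoc, Unitary.coe_star_mul_self, one_mul]

theorem norm_star_regularRep_conj (g h : G) (x : EllTwo G H →L[ℂ] EllTwo G H) :
    ‖star (regularRep G H g : EllTwo G H →L[ℂ] EllTwo G H) * x *
      (regularRep G H h : EllTwo G H →L[ℂ] EllTwo G H)‖ = ‖x‖ := by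
  rw [CStarRing.norm_mul_coe_unitary, ← Unitary.coe_star, CStarRing.norm_coe_unitary_mul]

variable {σ π}

theorem monomial_conj_sub (x y : A) (z : G) :
    star (inducedRep σ π x * (regularRep G H z : EllTwo G H →L[ℂ] EllTwo G H)) *
      inducedRep σ π y * (inducedRep σ π x * (regularRep G H z : EllTwo G H →L[ℂ] EllTwo G H)) -
      inducedRep σ π y =
    star (regularRep G H z : EllTwo G H →L[ℂ] EllTwo G H) *
      inducedRep σ π (star x * y * x - σ z y) *
      (regularRep G H z : EllTwo G H →L[ℂ] EllTwo G H) := by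
  rw [map_sub, mul_sub, sub_mul, star_regularRep_conj]
  simp only [star_mul, map_mul, map_star, mul_assoc]

theorem norm_monomial_conj_sub_le (x y : A) (z : G) :
    ‖star (inducedRep σ π x * (regularRep G H z : EllTwo G H →L[ℂ] EllTwo G H)) *
      inducedRep σ π y * (inducedRep σ π x * (regularRep G H z : EllTwo G H →L[ℂ] EllTwo G H)) -
      inducedRep σ π y‖ ≤ ‖star x * y * x - σ z y‖ := by
  rw [monomial_conj_sub, norm_star_regularRep_conj]
  exact NonUnitalStarAlgHom.norm_apply_le _ _

theorem norm_monomial_conj_sub (hπ : Function.Injective π) (x y : A) (z : G) :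
    ‖star (inducedRep σ π x * (regularRep G H z : EllTwo G H →L[ℂ] EllTwo G H)) *
      inducedRep σ π y * (inducedRep σ π x * (regularRep G H z : EllTwo G H →L[ℂ] EllTwo G H)) -
      inducedRep σ π y‖ = ‖star x * y * x - σ z y‖ := by
  rw [monomial_conj_sub, norm_star_regularRep_conj, norm_inducedRep σ π hπ]

theorem inducedRep_mem_monomials (d : A) : inducedRep σ π d ∈ monomials σ π :=
  ⟨d, 1, by simp⟩

theorem mul_mem_monomials {x y : EllTwo G H →L[ℂ] EllTwo G H} (hx : x ∈ monomials σ π)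
    (hy : y ∈ monomials σ π) : x * y ∈ monomials σ π := by
  obtain ⟨d, g, rfl⟩ := hx
  obtain ⟨e, h, rfl⟩ := hy
  refine ⟨d * σ g e, g * h, ?_⟩
  rw [mul_assoc, ← mul_assoc _ (inducedRep σ π e), regularRep_mul_inducedRep, map_mul, map_mul,
    Submonoid.coe_mul]
  simp only [mul_assoc]

theorem star_mem_monomials {x : EllTwo G H →L[ℂ] EllTwo G H} (hx : x ∈ monomials σ π) :
    star x ∈ monomials σ π := by
  obtain ⟨d, g, rfl⟩ := hx
  refine ⟨σ g⁻¹ (star d), g⁻¹, ?_⟩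
  rw [star_mul, star_regularRep, ← map_star, regularRep_mul_inducedRep]

/-- By covariance, monomials are closed under products and adjoints, so their span is already a
`*`-algebra. -/
theorem adjoin_le_span_monomials {x : EllTwo G H →L[ℂ] EllTwo G H}
    (hx : x ∈ NonUnitalStarAlgebra.adjoin ℂ (monomials σ π)) :
    x ∈ Submodule.span ℂ (monomials σ π) := by
  induction hx using NonUnitalStarAlgebra.adjoin_induction with
  | mem x hx => exact Submodule.subset_span hx
  | add x y _ _ hx hy => exact add_mem hx hy
  | zero => exact zero_mem _
  | mul x y _ _ hx hy =>
    have := Submodule.mul_mem_mul hx hy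
    rw [Submodule.span_mul_span] at this
    refine Submodule.span_mono ?_ this
    rintro _ ⟨x, hx, y, hy, rfl⟩
    exact mul_mem_monomials hx hy
  | smul r x _ hx => exact Submodule.smul_mem _ r hx
  | star x hx' hx =>
    clear hx'
    induction hx using Submodule.span_induction with
    | mem x hx => exact Submodule.subset_span (star_mem_monomials hx)
    | zero => simp
    | add x y _ _ hx hy => rw [star_add]; exact add_mem hx hy
    | smul r x _ hx => rw [star_smul]; exact Submodule.smul_mem _ _ hx

theorem norm_conj_le {B : Type*} [NonUnitalNormedRing B] [StarRing B] [CStarRing B]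
    (x y b : B) {K : ℝ} (hx : ‖x‖ ≤ K) (hy : ‖y‖ ≤ K) :
    ‖star x * b * y‖ ≤ K * ‖b‖ * K := by
  have hK : 0 ≤ K := (norm_nonneg _).trans hx
  refine (norm_mul_le _ _).trans (mul_le_mul ((norm_mul_le _ _).trans ?_) hy (norm_nonneg _)
    (by positivity))
  rw [norm_star]
  exact mul_le_mul_of_nonneg_right hx (norm_nonneg _)

/-- `‖star x * (star y * a * y) * x - a‖` is small if `star y * a * y` and `star x * a * x` are
close to `a`. -/
theorem norm_conj_mul_sub_le {B : Type*} [NonUnitalNormedRing B] [StarRing B] [CStarRing B]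
    (x y a : B) {K : ℝ} (hx : ‖x‖ ≤ K) :
    ‖star (y * x) * a * (y * x) - a‖ ≤
      K * ‖star y * a * y - a‖ * K + ‖star x * a * x - a‖ := by
  have h : star (y * x) * a * (y * x) - a =
      star x * (star y * a * y - a) * x + (star x * a * x - a) := by
    rw [star_mul]; noncomm_ring
  rw [h]
  exact (norm_add_le _ _).trans (add_le_add_left (norm_conj_le _ _ _ hx hx) _)

/-! ### Separation by monomials -/

variable [PartialOrder A] [StarOrderedRing A]

variable (σ π) in
/-- For all positive `a₁`, `a₂` there are monomials `s₁`, `s₂` with `s_j* a_j s_j` close to `a_j`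
and `s₁* c s₂` small for all `c` in `S`. -/
def Separates (S : Set (EllTwo G H →L[ℂ] EllTwo G H)) : Prop :=
  ∀ a₁ a₂ : A, 0 ≤ a₁ → 0 ≤ a₂ → ∀ ε : ℝ, 0 < ε →
    ∃ s₁ ∈ monomials σ π, ∃ s₂ ∈ monomials σ π,
      ‖star s₁ * inducedRep σ π a₁ * s₁ - inducedRep σ π a₁‖ < ε ∧
      ‖star s₂ * inducedRep σ π a₂ * s₂ - inducedRep σ π a₂‖ < ε ∧
      ∀ c ∈ S, ‖star s₁ * c * s₂‖ < ε

theorem IsGSeparating.separates_singleton (hσ : IsGSeparating σ)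
    {c : EllTwo G H →L[ℂ] EllTwo G H} (hc : c ∈ monomials σ π) : Separates σ π {c} := by
  obtain ⟨c, g, rfl⟩ := hc
  intro a b ha hb ε hε
  obtain ⟨s, t, h, k, h1, h2, h3⟩ := hσ a (σ g b) ha (map_nonneg (σ g) hb) c ε hε
  -- The second monomial is chosen so that `U(g)` moves past it: `U(g) σ_{g⁻¹}(t) U(g⁻¹kg) = t
  -- U(kg)`. Its invariance estimate is the one for `σ_g(b)`, transported by `σ_{g⁻¹}`.
  refine ⟨_, ⟨s, h, rfl⟩, _, ⟨σ g⁻¹ t, g⁻¹ * k * g, rfl⟩, (norm_monomial_conj_sub_le _ _ _).trans_lt h1,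
    (norm_monomial_conj_sub_le _ _ _).trans_lt ?_, ?_⟩
  · have : star (σ g⁻¹ t) * b * σ g⁻¹ t - σ (g⁻¹ * k * g) b =
        σ g⁻¹ (star t * σ g b * t - σ k (σ g b)) := by
      have hb : σ g⁻¹ (σ g b) = b := by
        rw [← StarAlgEquiv.mul_apply, ← map_mul, inv_mul_cancel, map_one]; rfl
      simp only [map_sub, map_mul, map_star, hb, StarAlgEquiv.mul_apply]
    rw [this]
    exact (NonUnitalStarAlgHom.norm_apply_le (σ g⁻¹) _).trans_lt h2
  · rintro _ rfl
    have : star (inducedRep σ π s * (regularRep G H h : EllTwo G H →L[ℂ] EllTwo G H)) *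
        (inducedRep σ π c * (regularRep G H g : EllTwo G H →L[ℂ] EllTwo G H)) *
        (inducedRep σ π (σ g⁻¹ t) *
          (regularRep G H (g⁻¹ * k * g) : EllTwo G H →L[ℂ] EllTwo G H)) =
        star (regularRep G H h : EllTwo G H →L[ℂ] EllTwo G H) *
        inducedRep σ π (star s * c * t) *
          (regularRep G H (k * g) : EllTwo G H →L[ℂ] EllTwo G H) := by
      have ht : σ g (σ g⁻¹ t) = t := by
        rw [← StarAlgEquiv.mul_apply, ← map_mul, mul_inv_cancel, map_one]; rfl
      have hu : (regularRep G H (k * g) : EllTwo G H →L[ℂ] EllTwo G H) =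
          (regularRep G H g : EllTwo G H →L[ℂ] EllTwo G H) *
            (regularRep G H (g⁻¹ * k * g) : EllTwo G H →L[ℂ] EllTwo G H) := by
        rw [← Submonoid.coe_mul, ← map_mul]; congr 2; group
      rw [hu, ← mul_assoc _ (inducedRep σ π (σ g⁻¹ t)), mul_assoc _ _ (inducedRep σ π (σ g⁻¹ t)),
        mul_assoc _ _ (inducedRep σ π (σ g⁻¹ t)), regularRep_mul_inducedRep, ht]
      simp only [star_mul, map_mul, map_star, mul_assoc]
    rw [this, norm_star_regularRep_conj]
    exact (NonUnitalStarAlgHom.norm_apply_le _ _).trans_lt h3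

/-- For one positive element: from approximate invariance of the cut-down to a norm-bounded
approximately invariant monomial. -/
theorem exists_bounded_conj {a : A} (ha : 0 ≤ a) {ε : ℝ} (hε : 0 < ε) :
    ∃ (k ψ : A) (K : ℝ), 0 ≤ k ∧ 0 ≤ K ∧ ∀ s : EllTwo G H →L[ℂ] EllTwo G H,
      ‖star s * inducedRep σ π k * s - inducedRep σ π k‖ < ε / 3 →
      ‖inducedRep σ π ψ * s‖ ≤ K ∧
      ‖star (inducedRep σ π ψ * s) * inducedRep σ π a * (inducedRep σ π ψ * s) -
        inducedRep σ π a‖ < ε := by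
  obtain ⟨k, y, φ, hk, hka, hy, hφ⟩ := exists_cutDown ha (η := ε / 3) (by positivity)
  refine ⟨k, φ * y, ‖inducedRep σ π φ‖ * √(‖inducedRep σ π k‖ + ε / 3), hk, by positivity,
    fun s hs => ⟨?_, ?_⟩⟩
  -- Since `y* y = k`, the C*-identity gives `‖y s‖² = ‖s* k s‖ ≤ ‖k‖ + ε/3`, whatever the norm of
  -- `s`.
  · rw [map_mul, mul_assoc]
    refine (norm_mul_le _ _).trans (mul_le_mul_of_nonneg_left (Real.le_sqrt_of_sq_le ?_)
      (norm_nonneg _))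
    rw [sq, ← CStarRing.norm_star_mul_self, star_mul, mul_assoc, ← mul_assoc _ _ s, ← map_star,
      ← map_mul, hy, ← mul_assoc]
    have := norm_sub_norm_le (star s * inducedRep σ π k * s) (inducedRep σ π k)
    linarith
  · have h : star (inducedRep σ π (φ * y) * s) * inducedRep σ π a * (inducedRep σ π (φ * y) * s) =
        star s * inducedRep σ π k * s := by
      rw [← hφ]
      simp only [star_mul, map_mul, map_star, mul_assoc]
    have h' : ‖inducedRep σ π k - inducedRep σ π a‖ ≤ ε / 3 := by
      rw [← map_sub]
      exact (NonUnitalStarAlgHom.norm_apply_le _ _).trans hka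
    rw [h]
    have := norm_sub_le_norm_sub_add_norm_sub (star s * inducedRep σ π k * s) (inducedRep σ π k)
      (inducedRep σ π a)
    linarith

/-- The separating monomials can be chosen in a ball that does not depend on `S`. -/
theorem exists_bounded_separates {a₁ a₂ : A} (h₁ : 0 ≤ a₁) (h₂ : 0 ≤ a₂) {ε : ℝ} (hε : 0 < ε) :
    ∃ (ψ₁ ψ₂ : A) (K : ℝ), 0 ≤ K ∧ ∀ S : Set (EllTwo G H →L[ℂ] EllTwo G H),
      Separates σ π ((fun c => star (inducedRep σ π ψ₁) * c * inducedRep σ π ψ₂) '' S) →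
      ∀ δ : ℝ, 0 < δ → ∃ s₁ ∈ monomials σ π, ∃ s₂ ∈ monomials σ π, ‖s₁‖ ≤ K ∧ ‖s₂‖ ≤ K ∧
        ‖star s₁ * inducedRep σ π a₁ * s₁ - inducedRep σ π a₁‖ < ε ∧
        ‖star s₂ * inducedRep σ π a₂ * s₂ - inducedRep σ π a₂‖ < ε ∧
        ∀ c ∈ S, ‖star s₁ * c * s₂‖ < δ := by
  obtain ⟨k₁, ψ₁, K₁, hk₁, hK₁, H₁⟩ := exists_bounded_conj (σ := σ) (π := π) h₁ hε
  obtain ⟨k₂, ψ₂, K₂, hk₂, hK₂, H₂⟩ := exists_bounded_conj (σ := σ) (π := π) h₂ hε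
  refine ⟨ψ₁, ψ₂, max K₁ K₂, hK₁.trans (le_max_left _ _), fun S hS δ hδ => ?_⟩
  obtain ⟨s₁, hs₁, s₂, hs₂, e₁, e₂, e₃⟩ := hS k₁ k₂ hk₁ hk₂ (min (ε / 3) δ) (by positivity)
  obtain ⟨b₁, d₁⟩ := H₁ s₁ (e₁.trans_le (min_le_left _ _))
  obtain ⟨b₂, d₂⟩ := H₂ s₂ (e₂.trans_le (min_le_left _ _))
  refine ⟨_, mul_mem_monomials (inducedRep_mem_monomials ψ₁) hs₁, _,
    mul_mem_monomials (inducedRep_mem_monomials ψ₂) hs₂, b₁.trans (le_max_left _ _),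
    b₂.trans (le_max_right _ _), d₁, d₂, fun c hc => ?_⟩
  have := (e₃ _ (Set.mem_image_of_mem _ hc)).trans_le (min_le_right _ _)
  simpa only [star_mul, mul_assoc] using this

theorem IsGSeparating.separates (hσ : IsGSeparating σ)
    {S : Set (EllTwo G H →L[ℂ] EllTwo G H)} (hfin : S.Finite) (hS : S ⊆ monomials σ π) :
    Separates σ π S := by
  induction S, hfin using Set.Finite.induction_on with
  | empty =>
    intro a₁ a₂ h₁ h₂ ε hε
    -- Approximate invariance is still required when `S` is empty; separating `c = 0` supplies it.
    obtain ⟨s₁, hs₁, s₂, hs₂, e₁, e₂, -⟩ :=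
      hσ.separates_singleton (π := π) (inducedRep_mem_monomials 0) a₁ a₂ h₁ h₂ ε hε
    exact ⟨s₁, hs₁, s₂, hs₂, e₁, e₂, by simp⟩
  | @insert c S _ _ ih =>
    intro a₁ a₂ h₁ h₂ ε hε
    obtain ⟨ψ₁, ψ₂, K, hK, hb⟩ :=
      exists_bounded_separates (σ := σ) (π := π) h₁ h₂ (half_pos hε)
    -- `K` bounds the later `t₁, t₂` and is already known, so the tolerance can absorb the factor `K
    -- * K`; the `+ 1` covers `K = 0`.
    obtain ⟨s₁, hs₁, s₂, hs₂, e₁, e₂, e₃⟩ := ih ((Set.subset_insert _ _).trans hS) a₁ a₂ h₁ h₂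
      (ε / 2 / (K * K + 1)) (by positivity)
    have hc : star s₁ * c * s₂ ∈ monomials σ π :=
      mul_mem_monomials (mul_mem_monomials (star_mem_monomials hs₁) (hS (Set.mem_insert _ _))) hs₂
    obtain ⟨t₁, ht₁, t₂, ht₂, n₁, n₂, f₁, f₂, f₃⟩ := hb {star s₁ * c * s₂} (by
      rw [Set.image_singleton]
      exact hσ.separates_singleton (mul_mem_monomials (mul_mem_monomials
        (star_mem_monomials (inducedRep_mem_monomials _)) hc) (inducedRep_mem_monomials _))) ε hε
    have hδ : ∀ x : ℝ, 0 ≤ x → x < ε / 2 / (K * K + 1) → K * x * K ≤ ε / 2 := fun x h0 hx => by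
      rw [lt_div_iff₀ (by positivity)] at hx
      nlinarith
    refine ⟨_, mul_mem_monomials hs₁ ht₁, _, mul_mem_monomials hs₂ ht₂, ?_, ?_, ?_⟩
    · have := norm_conj_mul_sub_le t₁ s₁ (inducedRep σ π a₁) n₁
      have := hδ _ (norm_nonneg _) e₁
      linarith
    · have := norm_conj_mul_sub_le t₂ s₂ (inducedRep σ π a₂) n₂
      have := hδ _ (norm_nonneg _) e₂
      linarith
    · have hassoc : ∀ x, star (s₁ * t₁) * x * (s₂ * t₂) = star t₁ * (star s₁ * x * s₂) * t₂ :=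
        fun x => by simp only [star_mul, mul_assoc]
      intro x hx
      rw [hassoc]
      obtain rfl | hx := Set.mem_insert_iff.1 hx
      · exact f₃ _ rfl
      · have := norm_conj_le t₁ t₂ (star s₁ * x * s₂) n₁ n₂
        have := hδ _ (norm_nonneg _) (e₃ x hx)
        linarith

theorem IsGSeparating.exists_monomials (hσ : IsGSeparating σ)
    {c : EllTwo G H →L[ℂ] EllTwo G H} (hc : c ∈ reducedCrossedProduct σ π) {a₁ a₂ : A}
    (h₁ : 0 ≤ a₁) (h₂ : 0 ≤ a₂) {ε : ℝ} (hε : 0 < ε) :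
    ∃ s₁ ∈ monomials σ π, ∃ s₂ ∈ monomials σ π,
      ‖star s₁ * inducedRep σ π a₁ * s₁ - inducedRep σ π a₁‖ < ε ∧
      ‖star s₂ * inducedRep σ π a₂ * s₂ - inducedRep σ π a₂‖ < ε ∧
      ‖star s₁ * c * s₂‖ < ε := by
  obtain ⟨ψ₁, ψ₂, K, hK, hb⟩ := exists_bounded_separates (σ := σ) (π := π) h₁ h₂ hε
  -- Half of `ε` pays for replacing `c` by a combination of monomials, at cost at most `K * K` times
  -- the distance; the other half is shared among the terms, weighted by their coefficients.
  obtain ⟨b, hb', hcb⟩ := Metric.mem_closure_iff.1 hc (ε / 2 / (K * K + 1)) (by positivity)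
  obtain ⟨n, f, m, rfl⟩ := Submodule.mem_span_set'.1 (adjoin_le_span_monomials hb')
  have hF : 0 ≤ ∑ i, ‖f i‖ := by positivity
  obtain ⟨s₁, hs₁, s₂, hs₂, n₁, n₂, e₁, e₂, e₃⟩ := hb (Set.range fun i => (m i).1) (by
      rw [← Set.range_comp]
      refine hσ.separates (Set.finite_range _) ?_
      rintro _ ⟨i, rfl⟩
      exact mul_mem_monomials (mul_mem_monomials (star_mem_monomials (inducedRep_mem_monomials _))
        (m i).2) (inducedRep_mem_monomials _)) (ε / 2 / ((∑ i, ‖f i‖) + 1)) (by positivity)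
  refine ⟨s₁, hs₁, s₂, hs₂, e₁, e₂, ?_⟩
  have hsum : ‖star s₁ * (∑ i, f i • (m i).1) * s₂‖ < ε / 2 := by
    have : star s₁ * (∑ i, f i • (m i).1) * s₂ = ∑ i, f i • (star s₁ * (m i).1 * s₂) := by
      simp only [Finset.mul_sum, Finset.sum_mul, mul_smul_comm, smul_mul_assoc]
    rw [this]
    calc ‖∑ i, f i • (star s₁ * (m i).1 * s₂)‖
        ≤ ∑ i, ‖f i‖ * (ε / 2 / ((∑ i, ‖f i‖) + 1)) := norm_sum_le_of_le _ fun i _ => by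
          rw [norm_smul]
          exact mul_le_mul_of_nonneg_left (e₃ _ ⟨i, rfl⟩).le (norm_nonneg _)
      _ < ε / 2 := by
          rw [← Finset.sum_mul, mul_div_assoc', div_lt_iff₀ (by positivity)]
          nlinarith
  have hdiff : ‖star s₁ * (c - ∑ i, f i • (m i).1) * s₂‖ ≤ ε / 2 := by
    refine (norm_conj_le _ _ _ n₁ n₂).trans ?_
    rw [dist_eq_norm, lt_div_iff₀ (by positivity)] at hcb
    have := norm_nonneg (c - ∑ i, f i • (m i).1)
    nlinarith
  have h : star s₁ * c * s₂ = star s₁ * (c - ∑ i, f i • (m i).1) * s₂ +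
      star s₁ * (∑ i, f i • (m i).1) * s₂ := by
    rw [mul_sub, sub_mul, sub_add_cancel]
  rw [h]
  exact (norm_add_le _ _).trans_lt (by linarith)

end CStarDynamics

theorem mainTheorem7 {G : Type*} [Group G] {A : Type*} [NonUnitalCStarAlgebra A]
    [PartialOrder A] [StarOrderedRing A] (σ : G →* (A ≃⋆ₐ[ℂ] A))
    {H : Type*} [NormedAddCommGroup H] [InnerProductSpace ℂ H] [CompleteSpace H]
    (π : A →⋆ₙₐ[ℂ] (H →L[ℂ] H)) (hπ : Function.Injective π) :
    CStarDynamics.IsGSeparating σ ↔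
      ∀ a₁ a₂ : A, 0 ≤ a₁ → 0 ≤ a₂ →
        ∀ c : CStarDynamics.reducedCrossedProduct σ π, ∀ ε : ℝ, 0 < ε →
          ∃ (d₁ d₂ : A) (g₁ g₂ : G) (s₁ s₂ : CStarDynamics.reducedCrossedProduct σ π),
            s₁ = CStarDynamics.monomial σ π d₁ g₁ ∧ s₂ = CStarDynamics.monomial σ π d₂ g₂ ∧
            ‖star s₁ * CStarDynamics.incl σ π a₁ * s₁ - CStarDynamics.incl σ π a₁‖ < ε ∧
            ‖star s₂ * CStarDynamics.incl σ π a₂ * s₂ - CStarDynamics.incl σ π a₂‖ < ε ∧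
            ‖star s₁ * c * s₂‖ < ε := by
  open CStarDynamics in
  constructor
  · intro hσ a₁ a₂ h₁ h₂ c ε hε
    obtain ⟨s₁, ⟨d₁, g₁, rfl⟩, s₂, ⟨d₂, g₂, rfl⟩, e₁, e₂, e₃⟩ :=
      hσ.exists_monomials c.2 h₁ h₂ hε
    exact ⟨d₁, d₂, g₁, g₂, _, _, rfl, rfl, e₁, e₂, e₃⟩
  · intro h a b ha hb c ε hε
    obtain ⟨d₁, d₂, g₁, g₂, _, _, rfl, rfl, e₁, e₂, e₃⟩ := h a b ha hb (incl σ π c) ε hε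
    refine ⟨d₁, d₂, g₁, g₂, ?_, ?_, ?_⟩
    · rw [← norm_monomial_conj_sub hπ]
      exact e₁
    · rw [← norm_monomial_conj_sub hπ]
      exact e₂
    -- The outer unitaries `U(g₁)*` and `U(g₂)` do not change the norm, even for `g₁ ≠ g₂`.
    · rw [← norm_inducedRep σ π hπ, ← norm_star_regularRep_conj g₁ g₂]
      refine lt_of_eq_of_lt (congrArg norm ?_) e₃
      simp only [map_mul, map_star]
      change _ = star (inducedRep σ π d₁ * (regularRep G H g₁ : EllTwo G H →L[ℂ] EllTwo G H)) *
        inducedRep σ π c * (inducedRep σ π d₂ * (regularRep G H g₂ : EllTwo G H →L[ℂ] EllTwo G H))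
      simp only [star_mul, mul_assoc]
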